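/- Let $\Gamma$ be a $\mathbb Z^d$-periodic graph: a simple graph with an action of $\mathbb Z^d$, written $u\mapsto u+a$, that is free on vertices, preserves edges, and has finitely many orbits of vertices and of edges. A fundamental domain is a finite set $W$ of vertices whose translates cover all vertices and with $|W|$ equal to the number of vertex orbits; a set $U$ of vertices has support $0$ if there are no $u,v\in U$ and $a\neq 0$ with an edge between $u$ and $v+a$. A labeling is a pair $(V,E)$ of a $\mathbb Z^d$-periodic function $V$ on vertices and a $\mathbb Z^d$-periodic symmetric function $E$ on edges, both complex valued. A property of labelings holds for a generic labeling if it holds on a nonempty Zariski open subset of the (finite-dimensional) complex vector space of all labelings. For a fundamental domain $W$ and a labeling $(V,E)$, let $L(z)$ be the $W\times W$ matrix of Laurent polynomials in $z=(z_1,\dots,z_d)$ $$L(z)_{u,v}=\delta_{u,v}V(u)+\sum_{a\in\mathbb Z^d:\,(u,v+a)\in\mathcal E(\Gamma)}E((u,v+a))z^a,\qquad D(z,\lambda)=\det(L(z)-\lambda I).$$ For $U\subseteq W$, let $D|_U(z,\lambda)$ be the same polynomial for the subgraph $\Gamma_U$ of $\Gamma$ induced on $\{u+a: u\in U,\ a\in\mathbb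 Z^d\}$, with the restricted labeling and the fundamental domain $U$. A linear factor in $\lambda$ of such a polynomial is a factor $\lambda-\lambda_0$ in $\mathbb C[z^{\pm1},\lambda]$ with $\lambda_0\in\mathbb C$. Theorem. Suppose that $\Gamma$ has no fundamental domain of support $0$, and let $W$ be a fundamental domain of $\Gamma$. If for a generic labeling $D(z,\lambda)$ has a linear factor in $\lambda$, then for a generic labeling there exists $i\in W$ such that $D|_{W\smallsetminus\{i\}}(z,\lambda)$ and $D(z,\lambda)$ share a linear factor in $\lambda$. -/

import Mathlib

/-- A `ℤ^d`-periodic graph on the vertex set `V`: a simple graph (no self-loops, no multiple edges)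
that is invariant under a free action of `ℤ^d` on `V`, with finite quotient graph, i.e. finitely
many orbits of vertices and finitely many orbits of edges. The translate `u + a` is `a +ᵥ u`. -/
structure PeriodicGraph (d : ℕ) (V : Type*) [AddAction (Fin d → ℤ) V] where
  graph : SimpleGraph V
  free : ∀ (a : Fin d → ℤ) (u : V), a +ᵥ u = u → a = 0
  adj_vadd : ∀ (a : Fin d → ℤ) {u v : V}, graph.Adj u v → graph.Adj (a +ᵥ u) (a +ᵥ v)
  finite_vertexOrbits : Finite (AddAction.orbitRel.Quotient (Fin d → ℤ) V)
  finite_edgeOrbits : {o : Set (V × V) | ∃ u v, graph.Adj u v ∧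
    o = AddAction.orbit (Fin d → ℤ) (u, v)}.Finite

namespace PeriodicGraph

variable {d : ℕ} {V : Type*} [AddAction (Fin d → ℤ) V]

/-- A fundamental domain: a finite set of vertices whose translates cover the vertex set and whose
number of elements is the number of vertex orbits. -/
def IsFundamentalDomain (_Γ : PeriodicGraph d V) (W : Finset V) : Prop :=
  (∀ u : V, ∃ a : Fin d → ℤ, ∃ w ∈ W, u = a +ᵥ w) ∧
    W.card = Nat.card (AddAction.orbitRel.Quotient (Fin d → ℤ) V)

/-- The support of a set `U` of vertices: the `a ∈ ℤ^d` such that there is an edge between `U`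
and `U + a`. -/
def vertexSupport (Γ : PeriodicGraph d V) (U : Finset V) : Set (Fin d → ℤ) :=
  {a | ∃ u ∈ U, ∃ v ∈ U, Γ.graph.Adj u (a +ᵥ v)}

/-- `U` has support `0`: its support is empty or `{0}`. -/
def HasSupportZero (Γ : PeriodicGraph d V) (U : Finset V) : Prop :=
  Γ.vertexSupport U = ∅ ∨ Γ.vertexSupport U = {0}

/-- Between a vertex and an orbit there are finitely many edges. -/
instance finite_translates (Γ : PeriodicGraph d V) (u v : V) :
    Finite {a : Fin d → ℤ // Γ.graph.Adj u (a +ᵥ v)} := by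
  have := Γ.finite_edgeOrbits.to_subtype
  refine Finite.of_injective
    (fun a : {a : Fin d → ℤ // Γ.graph.Adj u (a +ᵥ v)} =>
      (⟨AddAction.orbit (Fin d → ℤ) (u, a.1 +ᵥ v), u, a.1 +ᵥ v, a.2, rfl⟩ :
        {o : Set (V × V) | ∃ u v, Γ.graph.Adj u v ∧
          o = AddAction.orbit (Fin d → ℤ) (u, v)})) ?_
  rintro ⟨a, ha⟩ ⟨b, hb⟩ h
  have h1 : AddAction.orbit (Fin d → ℤ) (u, a +ᵥ v) = AddAction.orbit (Fin d → ℤ) (u, b +ᵥ v) :=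
    congrArg Subtype.val h
  have h2 : (u, a +ᵥ v) ∈ AddAction.orbit (Fin d → ℤ) (u, b +ᵥ v) :=
    h1 ▸ AddAction.mem_orbit_self _
  obtain ⟨g, hg⟩ := h2
  obtain ⟨hg1, hg2⟩ := Prod.mk.inj hg
  have hg0 : g = 0 := Γ.free g u hg1
  subst hg0
  have h3 : b +ᵥ v = a +ᵥ v := by simpa using hg2
  have h4 : (-a + b) +ᵥ v = v := by rw [add_vadd, h3, neg_vadd_vadd]
  exact Subtype.ext (neg_add_eq_zero.mp (Γ.free _ _ h4))

/-- A labeling `(V, E)`: a periodic potential on the vertices and a periodic symmetric edge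
labeling. A `Dart` is an ordered pair `(u, v)` of adjacent vertices. -/
@[ext] structure Labeling (Γ : PeriodicGraph d V) where
  potential : V → ℂ
  edge : Γ.graph.Dart → ℂ
  potential_vadd : ∀ (a : Fin d → ℤ) (u : V), potential (a +ᵥ u) = potential u
  edge_symm : ∀ e : Γ.graph.Dart, edge e.symm = edge e
  edge_vadd : ∀ (a : Fin d → ℤ) (u v : V) (h : Γ.graph.Adj u v),
    edge ⟨(a +ᵥ u, a +ᵥ v), Γ.adj_vadd a h⟩ = edge ⟨(u, v), h⟩

/-- The coordinates of a labeling: the values of the potential and of the edge labels. Each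
coordinate is repeated along its orbit. -/
def Labeling.coord {Γ : PeriodicGraph d V} (ℓ : Γ.Labeling) : V ⊕ Γ.graph.Dart → ℂ :=
  Sum.elim ℓ.potential ℓ.edge

/-- Algebraic subsets of the (finite-dimensional) space of labelings: common zero sets of
polynomials in the coordinates. -/
def IsAlgebraic {Γ : PeriodicGraph d V} (Z : Set Γ.Labeling) : Prop :=
  ∃ S : Set (MvPolynomial (V ⊕ Γ.graph.Dart) ℂ),
    Z = {ℓ | ∀ p ∈ S, MvPolynomial.eval ℓ.coord p = 0}

/-- A property of labelings is generic if it holds on a nonempty Zariski open set. -/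
def Generic {Γ : PeriodicGraph d V} (P : Γ.Labeling → Prop) : Prop :=
  ∃ O : Set Γ.Labeling, IsAlgebraic Oᶜ ∧ O.Nonempty ∧ ∀ ℓ ∈ O, P ℓ

open Classical in
/-- The Floquet matrix `L(z)` with respect to `W`. Its entries are Laurent polynomials in `z`,
with `z ^ a` represented by `AddMonoidAlgebra.single a 1`. The sum has finitely many terms
because of `finite_translates`. -/
noncomputable def Labeling.floquetMatrix {Γ : PeriodicGraph d V} (ℓ : Γ.Labeling)
    (W : Finset V) : Matrix W W (AddMonoidAlgebra ℂ (Fin d → ℤ)) :=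
  fun u v => (if u = v then AddMonoidAlgebra.single 0 (ℓ.potential u) else 0) +
    ∑ᶠ a : {a : Fin d → ℤ // Γ.graph.Adj (u : V) (a +ᵥ (v : V))},
      AddMonoidAlgebra.single a.1 (ℓ.edge ⟨((u : V), a.1 +ᵥ (v : V)), a.2⟩)

open Classical in
/-- The dispersion polynomial `D(z, λ) = det (L(z) - λ I)`, a polynomial in `λ` whose coefficients
are Laurent polynomials in `z`. -/
noncomputable def Labeling.dispersion {Γ : PeriodicGraph d V} (ℓ : Γ.Labeling)
    (W : Finset V) : Polynomial (AddMonoidAlgebra ℂ (Fin d → ℤ)) :=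
  ((ℓ.floquetMatrix W).map Polynomial.C -
    (Polynomial.X : Polynomial (AddMonoidAlgebra ℂ (Fin d → ℤ))) • 1).det

/-- `λ - c`, with `c` a complex constant, is a factor of `f(z, λ)`. -/
def HasLinearFactor (f : Polynomial (AddMonoidAlgebra ℂ (Fin d → ℤ))) (c : ℂ) : Prop :=
  Polynomial.X - Polynomial.C (AddMonoidAlgebra.single (0 : Fin d → ℤ) c) ∣ f

/-- The vertex set `{u + a | u ∈ U, a ∈ ℤ^d}` of the induced graph `Γ_U`, with its `ℤ^d`-action. -/
def translates (d : ℕ) {V : Type*} [AddAction (Fin d → ℤ) V] (U : Finset V) :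
    SubAddAction (Fin d → ℤ) V where
  carrier := {x | ∃ u ∈ U, ∃ a : Fin d → ℤ, x = a +ᵥ u}
  vadd_mem' := by
    rintro c x ⟨u, hu, a, rfl⟩
    exact ⟨u, hu, c + a, (add_vadd c a u).symm⟩

theorem mem_translates {U : Finset V} {u : V} (hu : u ∈ U) : u ∈ translates d U :=
  ⟨u, hu, 0, (zero_vadd _ u).symm⟩

/-- The induced `ℤ^d`-periodic graph `Γ_U`. -/
def induced (Γ : PeriodicGraph d V) (U : Finset V) : PeriodicGraph d (translates d U) where
  graph := Γ.graph.comap Subtype.val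
  free a u h := Γ.free a u (congrArg Subtype.val h)
  adj_vadd a _ _ h := Γ.adj_vadd a h
  finite_vertexOrbits := by
    refine Finite.of_surjective (fun u : U => (Quotient.mk _
      (⟨u.1, mem_translates u.2⟩ : translates d U) :
        AddAction.orbitRel.Quotient (Fin d → ℤ) (translates d U))) ?_
    intro q
    induction q using Quotient.inductionOn with
    | h x =>
      obtain ⟨x, u, hu, a, hx⟩ := x
      refine ⟨⟨u, hu⟩, Quotient.sound ?_⟩
      refine ⟨-a, Subtype.ext ?_⟩
      change -a +ᵥ x = u
      rw [hx, neg_vadd_vadd]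
  finite_edgeOrbits := by
    have hinj : Function.Injective
        (Set.image (Prod.map Subtype.val Subtype.val :
          translates d U × translates d U → V × V)) :=
      Set.image_injective.mpr (Subtype.val_injective.prodMap Subtype.val_injective)
    refine (Γ.finite_edgeOrbits.preimage hinj.injOn).subset ?_
    rintro o ⟨u, v, h, rfl⟩
    refine ⟨u.1, v.1, h, ?_⟩
    change _ '' Set.range _ = Set.range _
    rw [← Set.range_comp]
    rfl

/-- The induced labeling on `Γ_U`: restriction of the potential and of the edge labeling. -/
def Labeling.induced {Γ : PeriodicGraph d V} (ℓ : Γ.Labeling) (U : Finset V) :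
    (Γ.induced U).Labeling where
  potential u := ℓ.potential u.1
  edge e := ℓ.edge ⟨(e.fst.1, e.snd.1), e.adj⟩
  potential_vadd a u := ℓ.potential_vadd a u.1
  edge_symm e := ℓ.edge_symm ⟨(e.fst.1, e.snd.1), e.adj⟩
  edge_vadd a u v h := ℓ.edge_vadd a u.1 v.1 h

/-- `U`, regarded as a set of vertices of `Γ_U`. -/
def inducedDomain (d : ℕ) {V : Type*} [AddAction (Fin d → ℤ) V] (U : Finset V) :
    Finset (translates d U) :=
  U.attach.map (⟨fun u => ⟨u.1, mem_translates u.2⟩,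
    fun _ _ h => Subtype.ext (congrArg (fun x : translates d U => x.1) h)⟩ :
      {x // x ∈ U} ↪ translates d U)

/-- The dispersion polynomial `D|_U(z, λ)` of the induced operator on `Γ_U`. -/
noncomputable def Labeling.inducedDispersion {Γ : PeriodicGraph d V} (ℓ : Γ.Labeling)
    (U : Finset V) : Polynomial (AddMonoidAlgebra ℂ (Fin d → ℤ)) :=
  (ℓ.induced U).dispersion (inducedDomain d U)

end PeriodicGraph

/-!
Let `A` be the polynomial ring whose variables are the coordinates of a labeling (one for each
orbit of vertices and of undirected edges), and `F` an algebraic closure of its field of fractions.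
The labeling by the variables themselves has a Floquet matrix `L` with entries in `F[z^±1]`.

*From generic labelings to `F` and back.* The coefficients of `D(z, λ)` at the monomials `z^a`
generate an ideal of `A[λ]`. If a generic labeling has a linear factor, this ideal meets `A` only in
`0`, since an element of the intersection vanishes at all labelings in a nonempty open set. A prime
ideal above it that still avoids `A ∖ {0}` gives `θ ∈ F` with `det (L - θ) = 0`
(`exists_generic_eigenvalue`). Setting `z = 1` shows that `θ` is integral over `A`, so evaluation
at any labeling extends to `A[θ]`, and identities over `F` specialize to every labeling
(`exists_specialization`). It remains to find `i` such that the principal minor of `L - θ` that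
omits `i` is zero.

*Derivatives.* The partial derivatives of `A` extend to `F`. Let `P` be the adjugate of `L - θ` and
`S` its trace. Differentiating `det (L - θ) = 0` with Jacobi's formula in the potential at `w` gives
`P w w = (∂_w θ) S` (`adjugate_diag_eq`), and differentiating it in the label of an edge `(u, v + a)`
gives `z^a P v u + z^(-a) P u v = (∂_e θ) S` (`adjugate_edge_eq`).

*Conclusion.* Suppose that no `P w w` is zero. As `P` has rank one, the product of `z^a P v u` and
`z^(-a) P u v` is `P u u P v v`, a nonzero constant times `S^2`; their sum is a constant times `S`,
and so `z^a P v u` is itself a nonzero constant times `S`. Rank one also makes the triples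
`(u, v, a)` with this property composable, while for `u = v` the property forces `a = 0`. Hence these
triples define a translation-invariant equivalence relation on the vertices that contains adjacency
and separates each vertex from its proper translates. Translating the elements of a fundamental
domain into suitable classes makes its support zero (`exists_adjugate_eq_zero`,
`IsFundamentalDomain.exists_hasSupportZero`), contrary to the hypothesis.
-/

/-! ### Determinants and adjugates -/

namespace Matrix

variable {n R : Type*} [Fintype n] [DecidableEq n] [CommRing R]

theorem adjugate_diag_eq_det_submatrix (M : Matrix n n R) (i : n) :
    M.adjugate i i = (M.submatrix (Subtype.val : {j // j ≠ i} → n) Subtype.val).det := by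
  rw [adjugate_apply, twoBlockTriangular_det' _ (fun j => j = i)]
  · have h1 [Fintype {j // j = i}] :
        (toSquareBlockProp (M.updateRow i (Pi.single i 1)) fun j => j = i).det = 1 := by
      have : toSquareBlockProp (M.updateRow i (Pi.single i 1)) (fun j => j = i) = 1 := by
        ext ⟨a, rfl⟩ ⟨b, rfl⟩
        simp [toSquareBlockProp]
      rw [this, det_one]
    have h2 : toSquareBlockProp (M.updateRow i (Pi.single i 1)) (fun j => ¬j = i) =
        M.submatrix (Subtype.val : {j // j ≠ i} → n) Subtype.val := by
      ext a b
      simp [toSquareBlockProp, updateRow_ne a.2]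
    rw [← one_mul (det (M.submatrix _ _)), ← h2]
    exact congrArg (· * _) (@h1 (_))
  · rintro a rfl b hb
    simp [hb]

/-- A singular matrix over a domain has an adjugate of rank at most one, since the columns of the
adjugate lie in the kernel; here the `2 × 2` minors through a nonzero diagonal entry. -/
theorem adjugate_mul_adjugate_of_det_eq_zero [IsDomain R] {M : Matrix n n R} (hM : M.det = 0)
    {k : n} (hk : M.adjugate k k ≠ 0) (i l : n) :
    M.adjugate i l * M.adjugate k k = M.adjugate i k * M.adjugate k l := by
  set x : n → R := fun j => M.adjugate j l * M.adjugate k k - M.adjugate j k * M.adjugate k l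
    with hx
  have hMx : ∀ j, ∑ m, M j m * x m = 0 := by
    intro j
    have h1 : ∀ b, ∑ m, M j m * M.adjugate m b = 0 := by
      intro b
      have := congrFun (congrFun (mul_adjugate M) j) b
      simpa [mul_apply, hM] using this
    have : ∑ m, M j m * x m = (∑ m, M j m * M.adjugate m l) * M.adjugate k k -
        (∑ m, M j m * M.adjugate m k) * M.adjugate k l := by
      rw [Finset.sum_mul, Finset.sum_mul, ← Finset.sum_sub_distrib]
      exact Finset.sum_congr rfl fun m _ => by simp only [hx]; ring
    rw [this, h1, h1, zero_mul, zero_mul, sub_zero]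
  have h0 : x = 0 := by
    -- `x` vanishes at `k`, so it is also killed by `M` with row `k` replaced by a unit vector.
    refine eq_zero_of_mulVec_eq_zero (M := M.updateRow k (Pi.single k 1))
      (by rwa [← adjugate_apply]) ?_
    ext j
    by_cases hj : j = k
    · subst hj
      have hxj : x j = 0 := by simp only [hx]; ring
      simp [mulVec, hxj]
    · simpa [mulVec, dotProduct, updateRow_ne hj] using hMx j
  exact sub_eq_zero.mp (congrFun h0 i)

end Matrix

theorem Derivation.map_finset_prod {R A ι : Type*} [CommRing R] [CommRing A] [Algebra R A]
    [DecidableEq ι] (D : Derivation R A A) (s : Finset ι) (f : ι → A) :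
    D (∏ i ∈ s, f i) = ∑ i ∈ s, (∏ j ∈ s.erase i, f j) * D (f i) := by
  induction s using Finset.induction_on with
  | empty => simp
  | insert a s ha ih =>
    rw [Finset.prod_insert ha, D.leibniz, ih, Finset.sum_insert ha, Finset.erase_insert ha,
      smul_eq_mul, smul_eq_mul, Finset.mul_sum, add_comm]
    congr 1
    refine Finset.sum_congr rfl fun i hi => ?_
    have hia : a ≠ i := fun h => ha (h ▸ hi)
    rw [Finset.erase_insert_of_ne hia, Finset.prod_insert (by simp [ha])]
    ring

/-- Jacobi's formula. -/
theorem Derivation.map_det {R A n : Type*} [CommRing R] [CommRing A] [Algebra R A] [Fintype n]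
    [DecidableEq n] (D : Derivation R A A) (M : Matrix n n A) :
    D M.det = ∑ i, ∑ j, M.adjugate j i * D (M i j) := by
  have h1 : ∀ j, ∑ i, M.adjugate j i * D (M i j) =
      (M.updateCol j fun i => D (M i j)).det := by
    intro j
    rw [← Matrix.cramer_apply, Matrix.cramer_eq_adjugate_mulVec]
    rfl
  rw [Finset.sum_comm, Finset.sum_congr rfl fun j _ => h1 j]
  simp only [Matrix.det_apply']
  rw [map_sum, Finset.sum_comm]
  refine Finset.sum_congr rfl fun σ _ => ?_
  rw [D.leibniz, Derivation.map_finset_prod, D.map_intCast, smul_zero, add_zero, smul_eq_mul,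
    ← Finset.mul_sum]
  congr 1
  refine Finset.sum_congr rfl fun j _ => ?_
  rw [← Finset.mul_prod_erase _ _ (Finset.mem_univ j), Matrix.updateCol_self, mul_comm]
  congr 1
  exact Finset.prod_congr rfl fun k hk => by rw [Matrix.updateCol_ne (Finset.ne_of_mem_erase hk)]

/-! ### Derivations -/

/-- The derivation of an additive monoid algebra that differentiates the coefficients and treats
the monomials as constants. -/
noncomputable def Derivation.addMonoidAlgebra {k F G : Type*} [CommRing k] [CommRing F]
    [Algebra k F] [AddCommMonoid G] (D : Derivation k F F) :
    Derivation ℤ (AddMonoidAlgebra F G) (AddMonoidAlgebra F G) :=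
  Derivation.mk'
    (AddMonoidHom.toIntLinearMap
      { toFun := AddMonoidAlgebra.map (D : F →ₗ[k] F).toAddMonoidHom
        map_zero' := AddMonoidAlgebra.map_zero _
        map_add' := AddMonoidAlgebra.map_add _ })
    (by
      intro a b
      simp only [AddMonoidHom.coe_toIntLinearMap, AddMonoidHom.coe_mk, ZeroHom.coe_mk, smul_eq_mul]
      induction a using AddMonoidAlgebra.induction_linear with
      | zero => simp
      | add a a' ha ha' =>
        rw [add_mul, AddMonoidAlgebra.map_add, ha, ha', AddMonoidAlgebra.map_add]
        ring
      | single g r =>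
        induction b using AddMonoidAlgebra.induction_linear with
        | zero => simp
        | add b b' hb hb' =>
          rw [mul_add, AddMonoidAlgebra.map_add, hb, hb', AddMonoidAlgebra.map_add]
          ring
        | single h t =>
          simp only [AddMonoidAlgebra.single_mul_single, AddMonoidAlgebra.map_single]
          simp [AddMonoidAlgebra.single_add, add_comm h g])

@[simp]
theorem Derivation.addMonoidAlgebra_single {k F G : Type*} [CommRing k] [CommRing F]
    [Algebra k F] [AddCommMonoid G] (D : Derivation k F F) (g : G) (r : F) :
    D.addMonoidAlgebra (AddMonoidAlgebra.single g r) = AddMonoidAlgebra.single g (D r) :=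
  AddMonoidAlgebra.map_single _ _ _

open TensorProduct in
/-- Derivations extend along formally étale algebras. -/
theorem Derivation.exists_extension (k A F : Type*) [CommRing k] [CommRing A] [CommRing F]
    [Algebra k A] [Algebra A F] [Algebra k F] [IsScalarTower k A F] [Algebra.FormallyEtale A F]
    (D : Derivation k A F) : ∃ D' : Derivation k F F, ∀ a, D' (algebraMap A F a) = D a := by
  let f : F ⊗[A] Ω[A⁄k] →ₗ[F] F := LinearMap.liftBaseChange F D.liftKaehlerDifferential
  refine ⟨(f ∘ₗ (KaehlerDifferential.tensorKaehlerEquivOfFormallyEtale k A F).symm.toLinearMap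
    ).compDer (KaehlerDifferential.D k F), fun a => ?_⟩
  change f ((KaehlerDifferential.tensorKaehlerEquivOfFormallyEtale k A F).symm
    (KaehlerDifferential.D k F (algebraMap A F a))) = D a
  rw [KaehlerDifferential.tensorKaehlerEquivOfFormallyEtale_symm_D_algebraMap]
  simp [f]

/-- Evaluation of polynomials at a point extends to any integral extension ring. -/
theorem MvPolynomial.exists_eval_extension {σ B : Type*} [CommRing B]
    [Algebra (MvPolynomial σ ℂ) B] [Algebra.IsIntegral (MvPolynomial σ ℂ) B]
    (hinj : Function.Injective (algebraMap (MvPolynomial σ ℂ) B)) (y : σ → ℂ) :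
    ∃ Φ : B →+* ℂ, ∀ p, Φ (algebraMap (MvPolynomial σ ℂ) B p) = MvPolynomial.eval y p := by
  have hm : (RingHom.ker (MvPolynomial.eval y)).IsMaximal :=
    RingHom.ker_isMaximal_of_surjective _ fun c => ⟨MvPolynomial.C c, MvPolynomial.eval_C c⟩
  obtain ⟨Q, hQ, hQm⟩ := Ideal.exists_ideal_over_maximal_of_isIntegral (S := B)
    (RingHom.ker (MvPolynomial.eval y))
    (by rw [(RingHom.injective_iff_ker_eq_bot _).mp hinj]; exact bot_le)
  -- Over a maximal ideal of the polynomial ring, the residue field is again `ℂ`.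
  let f : ℂ →+* B ⧸ Q :=
    (Ideal.Quotient.mk Q).comp ((algebraMap (MvPolynomial σ ℂ) B).comp MvPolynomial.C)
  have hf : ∀ p, Ideal.Quotient.mk Q (algebraMap (MvPolynomial σ ℂ) B p) =
      f (MvPolynomial.eval y p) := by
    intro p
    refine Ideal.Quotient.eq.mpr ?_
    change algebraMap _ B p - algebraMap _ B (MvPolynomial.C (MvPolynomial.eval y p)) ∈ Q
    rw [← map_sub, ← Ideal.mem_comap, hQm, RingHom.mem_ker]
    simp
  have hfint : f.IsIntegral := by
    intro b
    obtain ⟨b, rfl⟩ := Ideal.Quotient.mk_surjective b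
    obtain ⟨p, hp, hpb⟩ := Algebra.IsIntegral.isIntegral (R := MvPolynomial σ ℂ) b
    refine ⟨p.map (MvPolynomial.eval y), hp.map _, ?_⟩
    rw [Polynomial.eval₂_map]
    have : f.comp (MvPolynomial.eval y) =
        (Ideal.Quotient.mk Q).comp (algebraMap (MvPolynomial σ ℂ) B) :=
      RingHom.ext fun p => (hf p).symm
    rw [this, ← Polynomial.hom_eval₂, hpb, map_zero]
  have hbij := IsAlgClosed.ringHom_bijective_of_isIntegral f hfint
  let e := RingEquiv.ofBijective f hbij
  refine ⟨(e.symm : B ⧸ Q →+* ℂ).comp (Ideal.Quotient.mk Q), fun p => ?_⟩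
  change e.symm (Ideal.Quotient.mk Q (algebraMap (MvPolynomial σ ℂ) B p)) = _
  rw [hf p]
  exact e.symm_apply_apply _

/-! ### An algebraic closure of the field of rational functions -/

/-- An algebraic closure of the field `ℂ(x_s : s ∈ σ)`. -/
abbrev RatFuncClosure (σ : Type*) : Type _ :=
  AlgebraicClosure (FractionRing (MvPolynomial σ ℂ))

namespace RatFuncClosure

variable (σ : Type*)

theorem algebraMap_injective :
    Function.Injective (algebraMap (MvPolynomial σ ℂ) (RatFuncClosure σ)) := by
  rw [IsScalarTower.algebraMap_eq (MvPolynomial σ ℂ) (FractionRing (MvPolynomial σ ℂ))]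
  exact (algebraMap (FractionRing (MvPolynomial σ ℂ)) _).injective.comp
    (IsFractionRing.injective _ _)

instance : Module.IsTorsionFree (MvPolynomial σ ℂ) (RatFuncClosure σ) := by
  have : FaithfulSMul (MvPolynomial σ ℂ) (RatFuncClosure σ) :=
    (faithfulSMul_iff_algebraMap_injective _ _).mpr (algebraMap_injective σ)
  infer_instance

instance : Algebra.FormallyEtale (MvPolynomial σ ℂ) (RatFuncClosure σ) := by
  have : Algebra.FormallyEtale (MvPolynomial σ ℂ) (FractionRing (MvPolynomial σ ℂ)) :=
    Algebra.FormallyEtale.of_isLocalization (nonZeroDivisors _)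
  have : Algebra.FormallyEtale (FractionRing (MvPolynomial σ ℂ)) (RatFuncClosure σ) :=
    Algebra.FormallyEtale.of_isSeparable _ _
  exact Algebra.FormallyEtale.comp _ (FractionRing (MvPolynomial σ ℂ)) _

variable {σ}

/-- The partial derivative in the variable `s` extends to the algebraic closure. -/
theorem exists_derivation [DecidableEq σ] (s : σ) :
    ∃ D : Derivation ℂ (RatFuncClosure σ) (RatFuncClosure σ),
      ∀ t, D (algebraMap (MvPolynomial σ ℂ) _ (MvPolynomial.X t)) = if t = s then 1 else 0 := by
  obtain ⟨D, hD⟩ := Derivation.exists_extension ℂ (MvPolynomial σ ℂ) (RatFuncClosure σ)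
    (MvPolynomial.mkDerivation ℂ fun t => if t = s then 1 else 0)
  refine ⟨D, fun t => ?_⟩
  rw [hD, MvPolynomial.mkDerivation_X]

end RatFuncClosure

namespace PeriodicGraph

variable {d : ℕ} {V : Type*} [AddAction (Fin d → ℤ) V]

/-! ### Fundamental domains of support zero -/

/-- Distinct elements of a fundamental domain lie in distinct orbits, because it has only as many
elements as there are orbits. -/
theorem IsFundamentalDomain.eq_of_vadd_eq {Γ : PeriodicGraph d V} {W : Finset V}
    (hW : Γ.IsFundamentalDomain W) {w w' : V} (hw : w ∈ W) (hw' : w' ∈ W) {a : Fin d → ℤ}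
    (h : a +ᵥ w = w') : w = w' := by
  have := Γ.finite_vertexOrbits
  let f : W → AddAction.orbitRel.Quotient (Fin d → ℤ) V := fun u => Quotient.mk _ u.1
  have hf : Function.Surjective f := by
    intro q
    induction q using Quotient.inductionOn with
    | h x =>
      obtain ⟨b, u, hu, hx⟩ := hW.1 x
      exact ⟨⟨u, hu⟩, Quotient.sound ⟨-b, by simp [hx]⟩⟩
  have hbij := hf.bijective_of_nat_card_le (by rw [← hW.2]; simp)
  have hEq : f ⟨w', hw'⟩ = f ⟨w, hw⟩ := Quotient.sound ⟨a, h⟩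
  exact (congrArg Subtype.val (hbij.1 hEq)).symm

theorem IsFundamentalDomain.vadd_inj {Γ : PeriodicGraph d V} {W : Finset V}
    (hW : Γ.IsFundamentalDomain W) {w w' : V} (hw : w ∈ W) (hw' : w' ∈ W) {a b : Fin d → ℤ}
    (h : a +ᵥ w = b +ᵥ w') : w = w' ∧ a = b := by
  have h1 : (-b + a) +ᵥ w = w' := by rw [add_vadd, h, neg_vadd_vadd]
  have h2 := hW.eq_of_vadd_eq hw hw' h1
  subst h2
  exact ⟨rfl, (neg_add_eq_zero.mp (Γ.free _ _ h1)).symm⟩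

/-- If some translation-invariant equivalence relation contains the adjacency relation and never
relates a vertex to a proper translate of itself, then a fundamental domain of support zero is
obtained by translating, inside each orbit of equivalence classes, all representatives into one
and the same class. -/
theorem IsFundamentalDomain.exists_hasSupportZero {Γ : PeriodicGraph d V} {W : Finset V}
    (hW : Γ.IsFundamentalDomain W) (r : Setoid V)
    (hr : ∀ (a : Fin d → ℤ) {x y : V}, r x y → r (a +ᵥ x) (a +ᵥ y))
    (hadj : ∀ {x y : V}, Γ.graph.Adj x y → r x y)
    (hfree : ∀ {a : Fin d → ℤ} {x : V}, r x (a +ᵥ x) → a = 0) :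
    ∃ W' : Finset V, Γ.IsFundamentalDomain W' ∧ Γ.HasSupportZero W' := by
  classical
  -- The orbits of equivalence classes.
  let q : Setoid V :=
    { r := fun x y => ∃ g : Fin d → ℤ, r x (g +ᵥ y)
      iseqv :=
        { refl := fun x => ⟨0, by rw [zero_vadd]⟩
          symm := by
            rintro x y ⟨g, hg⟩
            refine ⟨-g, r.symm ?_⟩
            have := hr (-g) hg
            rwa [neg_vadd_vadd] at this
          trans := by
            rintro x y z ⟨g, hg⟩ ⟨h, hh⟩
            refine ⟨g + h, r.trans hg ?_⟩
            rw [add_vadd]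
            exact hr g hh } }
  let rep : V → V := fun x => (Quotient.mk q x).out
  have hrep : ∀ x, ∃ g : Fin d → ℤ, r (rep x) (g +ᵥ x) := fun x => Quotient.mk_out (s := q) x
  choose g hg using hrep
  have hrepv : ∀ (a : Fin d → ℤ) x, rep (a +ᵥ x) = rep x := fun a x =>
    congrArg Quotient.out (Quotient.sound (s := q) ⟨a, r.refl _⟩)
  have hrepr : ∀ x y, r x y → rep x = rep y := fun x y h =>
    congrArg Quotient.out (Quotient.sound (s := q) ⟨0, by rwa [zero_vadd]⟩)
  refine ⟨W.image fun w => g w +ᵥ w, ⟨fun u => ?_, ?_⟩, ?_⟩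
  · obtain ⟨a, w, hw, rfl⟩ := hW.1 u
    exact ⟨a - g w, g w +ᵥ w, Finset.mem_image_of_mem _ hw, by rw [← add_vadd, sub_add_cancel]⟩
  · rw [Finset.card_image_of_injOn, hW.2]
    intro w hw w' hw' h
    exact (hW.vadd_inj hw hw' h).1
  · refine Set.subset_singleton_iff_eq.mp ?_
    rintro a ⟨x, hx, y, hy, hxy⟩
    obtain ⟨w, -, rfl⟩ := Finset.mem_image.mp hx
    obtain ⟨w', -, rfl⟩ := Finset.mem_image.mp hy
    have h1 := hadj hxy
    have h2 : rep w = rep w' := by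
      have := hrepr _ _ h1
      rwa [hrepv, hrepv, hrepv] at this
    have h3 : r (g w' +ᵥ w') (g w +ᵥ w) := r.trans (r.symm (hg w')) (h2 ▸ hg w)
    exact hfree (r.trans h3 h1)

/-! ### Coordinates on the space of labelings -/

/-- Two darts are equivalent if they carry the same label under every labeling: one is a translate
of the other or of its reverse. -/
def dartSetoid (Γ : PeriodicGraph d V) : Setoid Γ.graph.Dart where
  r e f := ∃ g : Fin d → ℤ,
    (f.fst = g +ᵥ e.fst ∧ f.snd = g +ᵥ e.snd) ∨ (f.fst = g +ᵥ e.snd ∧ f.snd = g +ᵥ e.fst)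
  iseqv :=
    { refl := fun e => ⟨0, Or.inl ⟨(zero_vadd _ _).symm, (zero_vadd _ _).symm⟩⟩
      symm := by
        rintro e f ⟨g, ⟨h1, h2⟩ | ⟨h1, h2⟩⟩
        · exact ⟨-g, Or.inl ⟨by rw [h1, neg_vadd_vadd], by rw [h2, neg_vadd_vadd]⟩⟩
        · exact ⟨-g, Or.inr ⟨by rw [h2, neg_vadd_vadd], by rw [h1, neg_vadd_vadd]⟩⟩
      trans := by
        rintro e f k ⟨g, ⟨h1, h2⟩ | ⟨h1, h2⟩⟩ ⟨g', ⟨h3, h4⟩ | ⟨h3, h4⟩⟩ <;>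
          refine ⟨g' + g, ?_⟩ <;> simp [h3, h4, h1, h2, add_vadd] }

/-- The index set of linear coordinates on the space of labelings: vertex orbits and orbits of
undirected edges. -/
abbrev Coord (Γ : PeriodicGraph d V) : Type _ :=
  AddAction.orbitRel.Quotient (Fin d → ℤ) V ⊕ Quotient Γ.dartSetoid

/-- The coordinate of a labeling that records its potential at `v`. -/
def vertexCoord (Γ : PeriodicGraph d V) (v : V) : Γ.Coord :=
  Sum.inl (Quotient.mk _ v)

/-- The coordinate of a labeling that records its value at the edge `e`. -/
def dartCoord (Γ : PeriodicGraph d V) (e : Γ.graph.Dart) : Γ.Coord :=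
  Sum.inr (Quotient.mk _ e)

/-- The labeling with given coordinates. -/
def Labeling.ofCoord {Γ : PeriodicGraph d V} (y : Γ.Coord → ℂ) : Γ.Labeling where
  potential v := y (Γ.vertexCoord v)
  edge e := y (Γ.dartCoord e)
  potential_vadd a _ := congrArg (fun s => y (Sum.inl s)) (Quotient.sound ⟨a, rfl⟩)
  edge_symm _ := congrArg (fun s => y (Sum.inr s)) (Quotient.sound
    ⟨0, Or.inr ⟨(zero_vadd _ _).symm, (zero_vadd _ _).symm⟩⟩)
  edge_vadd a _ _ _ := congrArg (fun s => y (Sum.inr s)) (Quotient.sound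
    ⟨-a, Or.inl ⟨(neg_vadd_vadd _ _).symm, (neg_vadd_vadd _ _).symm⟩⟩)

theorem Labeling.exists_ofCoord {Γ : PeriodicGraph d V} (ℓ : Γ.Labeling) :
    ∃ y, Labeling.ofCoord y = ℓ := by
  have hd : ∀ e f : Γ.graph.Dart, Γ.dartSetoid e f → ℓ.edge e = ℓ.edge f := by
    rintro ⟨⟨u, v⟩, h⟩ ⟨⟨u', v'⟩, h'⟩ ⟨g, ⟨h1, h2⟩ | ⟨h1, h2⟩⟩
    · obtain rfl : u' = g +ᵥ u := h1
      obtain rfl : v' = g +ᵥ v := h2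
      exact (ℓ.edge_vadd g u v h).symm
    · obtain rfl : u' = g +ᵥ v := h1
      obtain rfl : v' = g +ᵥ u := h2
      exact ((ℓ.edge_vadd g v u h.symm).trans (ℓ.edge_symm ⟨(u, v), h⟩)).symm
  have hv : ∀ u v : V, AddAction.orbitRel (Fin d → ℤ) V u v → ℓ.potential u = ℓ.potential v := by
    rintro u v ⟨a, rfl⟩
    exact ℓ.potential_vadd a v
  exact ⟨Sum.elim (Quotient.lift ℓ.potential hv) (Quotient.lift ℓ.edge hd), rfl⟩

theorem Labeling.coord_ofCoord {Γ : PeriodicGraph d V} (y : Γ.Coord → ℂ) :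
    (Labeling.ofCoord y).coord = y ∘ Sum.elim Γ.vertexCoord Γ.dartCoord := by
  ext (v | e) <;> rfl

theorem IsFundamentalDomain.vertexCoord_inj {Γ : PeriodicGraph d V} {W : Finset V}
    (hW : Γ.IsFundamentalDomain W) (u v : W) : Γ.vertexCoord u = Γ.vertexCoord v ↔ u = v := by
  refine ⟨fun h => ?_, fun h => by rw [h]⟩
  obtain ⟨a, ha⟩ := Quotient.exact (Sum.inl_injective h)
  exact (Subtype.ext (hW.eq_of_vadd_eq v.2 u.2 ha)).symm

theorem IsFundamentalDomain.dartCoord_inj {Γ : PeriodicGraph d V} {W : Finset V}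
    (hW : Γ.IsFundamentalDomain W) {u v u₀ v₀ : W} {a a₀ : Fin d → ℤ}
    (h : Γ.graph.Adj (u : V) (a +ᵥ (v : V))) (h₀ : Γ.graph.Adj (u₀ : V) (a₀ +ᵥ (v₀ : V))) :
    Γ.dartCoord ⟨(_, _), h⟩ = Γ.dartCoord ⟨(_, _), h₀⟩ ↔
      (a = a₀ ∧ u = u₀ ∧ v = v₀) ∨ (a = -a₀ ∧ u = v₀ ∧ v = u₀) := by
  constructor
  · intro hh
    obtain ⟨g, ⟨h1, h2⟩ | ⟨h1, h2⟩⟩ := Quotient.exact (Sum.inr_injective hh)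
    · change (u₀ : V) = g +ᵥ (u : V) at h1
      change a₀ +ᵥ (v₀ : V) = g +ᵥ (a +ᵥ (v : V)) at h2
      rw [← zero_vadd (Fin d → ℤ) (u₀ : V)] at h1
      obtain ⟨e1, rfl⟩ := hW.vadd_inj u₀.2 u.2 h1
      rw [zero_vadd] at h2
      obtain ⟨e2, rfl⟩ := hW.vadd_inj v₀.2 v.2 h2
      exact Or.inl ⟨rfl, Subtype.ext e1.symm, Subtype.ext e2.symm⟩
    · change (u₀ : V) = g +ᵥ (a +ᵥ (v : V)) at h1
      change a₀ +ᵥ (v₀ : V) = g +ᵥ (u : V) at h2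
      rw [← zero_vadd (Fin d → ℤ) (u₀ : V), ← add_vadd] at h1
      obtain ⟨e1, e3⟩ := hW.vadd_inj u₀.2 v.2 h1
      obtain ⟨e2, rfl⟩ := hW.vadd_inj v₀.2 u.2 h2
      exact Or.inr ⟨(neg_eq_of_add_eq_zero_right e3.symm).symm, Subtype.ext e2.symm,
        Subtype.ext e1.symm⟩
  · rintro (⟨rfl, rfl, rfl⟩ | ⟨rfl, rfl, rfl⟩)
    · rfl
    · exact congrArg Sum.inr (Quotient.sound
        ⟨a₀, Or.inr ⟨(vadd_neg_vadd a₀ _).symm, rfl⟩⟩)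

/-! ### The Floquet matrix with coefficients in a ring -/

section

variable {R S : Type*} [CommRing R] [CommRing S]

open Classical in
/-- The matrix `L(z) - c` of the labeling with coordinates `x` in an arbitrary coefficient ring. -/
noncomputable def shiftedFloquet (Γ : PeriodicGraph d V) (W : Finset V) (x : Γ.Coord → R) (c : R) :
    Matrix W W (AddMonoidAlgebra R (Fin d → ℤ)) :=
  fun u v => (if u = v then AddMonoidAlgebra.single 0 (x (Γ.vertexCoord u) - c) else 0) +
    ∑ᶠ a : {a : Fin d → ℤ // Γ.graph.Adj (u : V) (a +ᵥ (v : V))},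
      AddMonoidAlgebra.single a.1 (x (Γ.dartCoord ⟨((u : V), a.1 +ᵥ (v : V)), a.2⟩))

/-- The Floquet matrix is additive in the labels, so it commutes with additive maps that act on the
coefficients; this covers ring homomorphisms and derivations alike. -/
theorem map_shiftedFloquet (Γ : PeriodicGraph d V) (W : Finset V) (f : R →+ S)
    (φ : AddMonoidAlgebra R (Fin d → ℤ) →+ AddMonoidAlgebra S (Fin d → ℤ))
    (hφ : ∀ a r, φ (AddMonoidAlgebra.single a r) = AddMonoidAlgebra.single a (f r))
    (x : Γ.Coord → R) (c : R) (u v : W) :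
    φ (Γ.shiftedFloquet W x c u v) = Γ.shiftedFloquet W (f ∘ x) (f c) u v := by
  simp only [shiftedFloquet]
  rw [map_add, AddMonoidHom.map_finsum _ (Set.toFinite _)]
  congr 1
  · split_ifs <;> simp [hφ]
  · exact finsum_congr fun a => hφ _ _

theorem shiftedFloquet_map (Γ : PeriodicGraph d V) (W : Finset V) (f : R →+* S)
    (x : Γ.Coord → R) (c : R) :
    (Γ.shiftedFloquet W x c).map (AddMonoidAlgebra.mapRingHom (Fin d → ℤ) f) =
      Γ.shiftedFloquet W (f ∘ x) (f c) := by
  ext1 u v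
  exact Γ.map_shiftedFloquet W (f : R →+ S)
    (AddMonoidAlgebra.mapRingHom (Fin d → ℤ) f : _ →+ _)
    (fun a r => AddMonoidAlgebra.mapRingHom_single f a r) x c u v

end

/-! ### Linear factors and determinants -/

section

variable {Γ : PeriodicGraph d V}

open Classical in
theorem Labeling.hasLinearFactor_dispersion_iff (ℓ : Γ.Labeling) (W : Finset V) (c : ℂ) :
    HasLinearFactor (ℓ.dispersion W) c ↔
      (ℓ.floquetMatrix W - (AddMonoidAlgebra.single (0 : Fin d → ℤ) c) • 1).det = 0 := by
  rw [HasLinearFactor, Polynomial.dvd_iff_isRoot, Polynomial.IsRoot, Labeling.dispersion,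
    ← Polynomial.coe_evalRingHom, RingHom.map_det]
  have : (Polynomial.evalRingHom (AddMonoidAlgebra.single (0 : Fin d → ℤ) c)).mapMatrix
      ((ℓ.floquetMatrix W).map Polynomial.C -
        (Polynomial.X : Polynomial (AddMonoidAlgebra ℂ (Fin d → ℤ))) • 1) =
      ℓ.floquetMatrix W - (AddMonoidAlgebra.single (0 : Fin d → ℤ) c) • 1 := by
    ext1 u v
    by_cases h : u = v <;> simp [h]
  rw [this]

open Classical in
theorem shiftedFloquet_eq (y : Γ.Coord → ℂ) (W : Finset V) (c : ℂ) :
    Γ.shiftedFloquet W y c = (Labeling.ofCoord y).floquetMatrix W -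
      (AddMonoidAlgebra.single (0 : Fin d → ℤ) c) • 1 := by
  ext1 u v
  simp only [shiftedFloquet, Labeling.floquetMatrix, Matrix.sub_apply, Matrix.smul_apply]
  by_cases h : u = v
  · subst h
    simp only [if_true, Matrix.one_apply_eq, smul_eq_mul, mul_one, AddMonoidAlgebra.single_sub]
    rw [sub_add_eq_add_sub]
    rfl
  · simp only [if_neg h, Matrix.one_apply_ne h, smul_zero, sub_zero]
    rfl

open Classical in
theorem hasLinearFactor_dispersion_ofCoord (y : Γ.Coord → ℂ) (W : Finset V) (c : ℂ) :
    HasLinearFactor ((Labeling.ofCoord y).dispersion W) c ↔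
      (Γ.shiftedFloquet W y c).det = 0 := by
  rw [Labeling.hasLinearFactor_dispersion_iff, shiftedFloquet_eq]

open Classical in
/-- The induced dispersion polynomial is a principal minor of `L(z) - λ`. -/
theorem hasLinearFactor_inducedDispersion_ofCoord (y : Γ.Coord → ℂ) (W : Finset V) (i : W)
    (c : ℂ) :
    HasLinearFactor ((Labeling.ofCoord y).inducedDispersion (W.erase i)) c ↔
      (Γ.shiftedFloquet W y c).adjugate i i = 0 := by
  have hmem : ∀ j : {j : W // j ≠ i}, (j.1 : V) ∈ W.erase i := fun j =>
    Finset.mem_erase.mpr ⟨fun h => j.2 (Subtype.ext h), j.1.2⟩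
  let f : {j : W // j ≠ i} → inducedDomain d (W.erase (i : V)) := fun j =>
    ⟨⟨j.1.1, mem_translates (hmem j)⟩,
      Finset.mem_map.mpr ⟨⟨j.1.1, hmem j⟩, Finset.mem_attach _ _, rfl⟩⟩
  have hf : Function.Bijective f := by
    constructor
    · intro j k h
      exact Subtype.ext (Subtype.ext (congrArg (fun x => x.1.1) h))
    · rintro ⟨x, hx⟩
      obtain ⟨⟨u, hu⟩, -, rfl⟩ := Finset.mem_map.mp hx
      exact ⟨⟨⟨u, Finset.mem_of_mem_erase hu⟩,
        fun h => Finset.ne_of_mem_erase hu (congrArg Subtype.val h)⟩, rfl⟩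
  have hM : (Γ.shiftedFloquet W y c).submatrix (Subtype.val : {j // j ≠ i} → W) Subtype.val =
      ((((Labeling.ofCoord y).induced (W.erase i)).floquetMatrix (inducedDomain d (W.erase i)) -
        (AddMonoidAlgebra.single (0 : Fin d → ℤ) c) • 1).submatrix
          (Equiv.ofBijective f hf) (Equiv.ofBijective f hf)) := by
    rw [shiftedFloquet_eq]
    ext1 j k
    have hjk : f j = f k ↔ j.1 = k.1 := hf.1.eq_iff.trans Subtype.ext_iff
    simp only [Matrix.submatrix_apply, Equiv.ofBijective_apply, Labeling.floquetMatrix,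
      Matrix.sub_apply, Matrix.smul_apply, Matrix.one_apply, hjk]
    rfl
  rw [Labeling.inducedDispersion, Labeling.hasLinearFactor_dispersion_iff,
    Matrix.adjugate_diag_eq_det_submatrix, hM, Matrix.det_submatrix_equiv_self]
  convert Iff.rfl

end

/-! ### Derivatives of an eigenvalue that is constant in the quasimomentum -/

section

variable {Γ : PeriodicGraph d V} {W : Finset V} {k F : Type*} [CommRing k] [Field F]
  [Algebra k F]

open Classical in
/-- The derivative of `det (L - θ) = 0`; the derivative of `L - θ` is the Floquet matrix of the
differentiated labels, shifted by the derivative of `θ`. -/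
theorem sum_adjugate_mul_deriv {x : Γ.Coord → F} {θ : F}
    (hdet : (Γ.shiftedFloquet W x θ).det = 0) (D : Derivation k F F) :
    ∑ u, ∑ v, (Γ.shiftedFloquet W x θ).adjugate v u *
      Γ.shiftedFloquet W (D ∘ x) (D θ) u v = 0 := by
  have h := D.addMonoidAlgebra (G := Fin d → ℤ) |>.map_det (Γ.shiftedFloquet W x θ)
  rw [hdet, map_zero] at h
  rw [h]
  refine Finset.sum_congr rfl fun u _ => Finset.sum_congr rfl fun v _ => ?_
  exact congrArg _ (Γ.map_shiftedFloquet W (AddMonoidHomClass.toAddMonoidHom D)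
    (AddMonoidHomClass.toAddMonoidHom (D.addMonoidAlgebra (G := Fin d → ℤ)))
    (fun a r => D.addMonoidAlgebra_single a r) x θ u v).symm

open Classical in
/-- The sum of the principal minors of order `|W| - 1` of `L(z) - θ`, which is up to sign the
derivative at `θ` of the dispersion polynomial. -/
noncomputable def minorSum (Γ : PeriodicGraph d V) (W : Finset V) (x : Γ.Coord → F) (θ : F) :
    AddMonoidAlgebra F (Fin d → ℤ) :=
  ∑ u, (Γ.shiftedFloquet W x θ).adjugate u u

open Classical in
/-- The derivative of `det (L - θ) = 0` in the potential at `w`. -/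
theorem adjugate_diag_eq (hW : Γ.IsFundamentalDomain W) {x : Γ.Coord → F} {θ : F}
    (hdet : (Γ.shiftedFloquet W x θ).det = 0) (w : W) {D : Derivation k F F}
    (hD : ∀ t, D (x t) = if t = Γ.vertexCoord w then 1 else 0) :
    (Γ.shiftedFloquet W x θ).adjugate w w =
      AddMonoidAlgebra.single 0 (D θ) * Γ.minorSum W x θ := by
  have h := sum_adjugate_mul_deriv hdet D
  have hentry : ∀ u v : W, Γ.shiftedFloquet W (D ∘ x) (D θ) u v =
      if u = v then (if u = w then 1 else 0) - AddMonoidAlgebra.single 0 (D θ) else 0 := by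
    intro u v
    have h2 : ∀ e, D (x (Γ.dartCoord e)) = 0 := fun e => by
      rw [hD, if_neg]
      exact Sum.inr_ne_inl
    simp only [shiftedFloquet, Function.comp_apply, h2, AddMonoidAlgebra.single_zero, finsum_zero,
      add_zero, hD, hW.vertexCoord_inj, AddMonoidAlgebra.single_sub]
    congr 2
    split_ifs <;> simp [AddMonoidAlgebra.one_def]
  simp only [hentry, mul_ite, mul_zero, Finset.sum_ite_eq, Finset.mem_univ, if_true, mul_sub,
    Finset.sum_sub_distrib, mul_one, Finset.sum_ite_eq'] at h
  rw [sub_eq_zero.mp h, minorSum, Finset.mul_sum]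
  exact Finset.sum_congr rfl fun u _ => mul_comm _ _

theorem finsum_single_ite {p : (Fin d → ℤ) → Prop} [Finite {a // p a}] (a₀ : Fin d → ℤ)
    (Q : Prop) [Decidable Q] (hQ : Q → p a₀) :
    ∑ᶠ a : {a // p a}, AddMonoidAlgebra.single a.1 (if a.1 = a₀ ∧ Q then (1 : F) else 0) =
      if Q then AddMonoidAlgebra.single a₀ 1 else 0 := by
  by_cases h : Q
  · rw [finsum_eq_single _ ⟨a₀, hQ h⟩]
    · simp [h]
    · intro a ha
      rw [if_neg, AddMonoidAlgebra.single_zero]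
      exact fun h' => ha (Subtype.ext h'.1)
  · simp [h]

open Classical in
/-- The derivative of `det (L - θ) = 0` in the label of the edge `(u₀, a₀ +ᵥ v₀)`, which occurs in
two terms of the Floquet matrix. -/
theorem adjugate_edge_eq (hW : Γ.IsFundamentalDomain W) {x : Γ.Coord → F} {θ : F}
    (hdet : (Γ.shiftedFloquet W x θ).det = 0) {u₀ v₀ : W} {a₀ : Fin d → ℤ}
    (h₀ : Γ.graph.Adj (u₀ : V) (a₀ +ᵥ (v₀ : V))) {D : Derivation k F F}
    (hD : ∀ t, D (x t) = if t = Γ.dartCoord ⟨(_, _), h₀⟩ then 1 else 0) :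
    (Γ.shiftedFloquet W x θ).adjugate v₀ u₀ * AddMonoidAlgebra.single a₀ 1 +
      (Γ.shiftedFloquet W x θ).adjugate u₀ v₀ * AddMonoidAlgebra.single (-a₀) 1 =
      AddMonoidAlgebra.single 0 (D θ) * Γ.minorSum W x θ := by
  have h := sum_adjugate_mul_deriv hdet D
  have h₀' : Γ.graph.Adj (v₀ : V) (-a₀ +ᵥ (u₀ : V)) := by
    simpa using Γ.adj_vadd (-a₀) h₀.symm
  have hentry : ∀ u v : W, Γ.shiftedFloquet W (D ∘ x) (D θ) u v =
      ((if u = u₀ ∧ v = v₀ then AddMonoidAlgebra.single a₀ 1 else 0) +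
        (if u = v₀ ∧ v = u₀ then AddMonoidAlgebra.single (-a₀) 1 else 0)) -
      if u = v then AddMonoidAlgebra.single 0 (D θ) else 0 := by
    intro u v
    have h2 : ∀ v, D (x (Γ.vertexCoord v)) = 0 := fun v => by
      rw [hD, if_neg]
      exact Sum.inl_ne_inr
    rw [← finsum_single_ite (p := fun a => Γ.graph.Adj (u : V) (a +ᵥ (v : V))) a₀
        (u = u₀ ∧ v = v₀) (by rintro ⟨rfl, rfl⟩; exact h₀),
      ← finsum_single_ite (p := fun a => Γ.graph.Adj (u : V) (a +ᵥ (v : V))) (-a₀)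
        (u = v₀ ∧ v = u₀) (by rintro ⟨rfl, rfl⟩; exact h₀'),
      ← finsum_add_distrib (Set.toFinite _) (Set.toFinite _)]
    simp only [shiftedFloquet, Function.comp_apply, h2, zero_sub, hD, hW.dartCoord_inj]
    rw [add_comm, sub_eq_add_neg]
    congr 1
    · refine finsum_congr fun a => ?_
      rw [← AddMonoidAlgebra.single_add]
      congr 1
      by_cases p1 : a.1 = a₀ ∧ u = u₀ ∧ v = v₀
      · have p2 : ¬(a.1 = -a₀ ∧ u = v₀ ∧ v = u₀) := by
          rintro ⟨q1, q2, q3⟩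
          obtain ⟨r1, r2, r3⟩ := p1
          -- Otherwise the edge would be a loop.
          have ha : a₀ = 0 := by
            have : a₀ = -a₀ := r1.symm.trans q1
            funext k
            have := congrFun this k
            simp only [Pi.neg_apply] at this
            simp only [Pi.zero_apply]
            omega
          rw [← r2, ← r3, q2, q3, ha, zero_vadd] at h₀
          have huv : (u₀ : W) = v₀ := r2.symm.trans q2
          rw [huv] at h₀
          exact Γ.graph.loopless.irrefl _ h₀
        rw [if_pos (Or.inl p1), if_pos p1, if_neg p2, add_zero]
      · simp [p1]
    · split_ifs <;> simp
  simp only [hentry, mul_sub, mul_add, Finset.sum_sub_distrib, Finset.sum_add_distrib, mul_ite,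
    mul_zero, Finset.sum_ite_eq, Finset.mem_univ, if_true, ite_and] at h
  simp only [Finset.sum_ite_irrel, Finset.sum_ite_eq', Finset.mem_univ, if_true,
    Finset.sum_const_zero] at h
  rw [sub_eq_zero.mp h, minorSum, Finset.mul_sum]
  exact Finset.sum_congr rfl fun u _ => mul_comm _ _

end

/-! ### A principal minor with the same linear factor -/

/-- Over an algebraically closed field, if the sum and the product of two elements of an integral
domain are constant multiples of `S` and `S ^ 2`, then the elements are constant multiples
of `S`. -/
theorem exists_eq_single_mul {F G : Type*} [Field F] [IsAlgClosed F] [AddCommMonoid G]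
    [NoZeroDivisors (AddMonoidAlgebra F G)] {p q S : AddMonoidAlgebra F G} {c e : F} (he : e ≠ 0)
    (hadd : p + q = AddMonoidAlgebra.single 0 c * S)
    (hmul : p * q = AddMonoidAlgebra.single 0 e * S ^ 2) :
    ∃ α : F, α ≠ 0 ∧ p = AddMonoidAlgebra.single 0 α * S := by
  obtain ⟨α, hα⟩ := IsAlgClosed.exists_root
    (Polynomial.X ^ 2 - Polynomial.C c * Polynomial.X + Polynomial.C e) (by
      have : (Polynomial.X ^ 2 - Polynomial.C c * Polynomial.X + Polynomial.C e).degree = 2 := by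
        compute_degree!
      rw [this]
      exact two_ne_zero)
  simp only [Polynomial.IsRoot, Polynomial.eval_add, Polynomial.eval_sub, Polynomial.eval_pow,
    Polynomial.eval_X, Polynomial.eval_mul, Polynomial.eval_C] at hα
  have he' : e = α * (c - α) := by linear_combination hα
  have hα0 : α ≠ 0 := by
    rintro rfl
    exact he (by simpa using he')
  have hβ0 : c - α ≠ 0 := by
    intro h
    exact he (by rw [he', h, mul_zero])
  have hfac : (p - AddMonoidAlgebra.single 0 α * S) *
      (p - AddMonoidAlgebra.single 0 (c - α) * S) = 0 := by
    have h1 : (AddMonoidAlgebra.single 0 e : AddMonoidAlgebra F G) =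
        AddMonoidAlgebra.single 0 α * AddMonoidAlgebra.single 0 (c - α) := by
      rw [AddMonoidAlgebra.single_mul_single, add_zero, he']
    have h2 : (AddMonoidAlgebra.single 0 c : AddMonoidAlgebra F G) =
        AddMonoidAlgebra.single 0 α + AddMonoidAlgebra.single 0 (c - α) := by
      rw [← AddMonoidAlgebra.single_add, add_sub_cancel]
    rw [h1] at hmul
    rw [h2] at hadd
    linear_combination p * hadd - hmul
  rcases mul_eq_zero.mp hfac with h | h
  · exact ⟨α, hα0, sub_eq_zero.mp h⟩
  · exact ⟨c - α, hβ0, sub_eq_zero.mp h⟩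

variable {Γ : PeriodicGraph d V} {W : Finset V}

open Classical in
/-- The heart of the argument, for a constant eigenvalue `θ` of the Floquet matrix of a labeling
that admits all partial derivatives. If no principal minor vanished, each entry of the adjugate
along an edge would be a monomial times the sum `S` of the principal minors, with exponent the
translation that the edge involves. As the adjugate has rank one, the exponents add up along paths,
so that no path joins a vertex to a proper translate of itself. -/
theorem exists_adjugate_eq_zero (hW : Γ.IsFundamentalDomain W)
    (hΓ : ¬ ∃ W' : Finset V, Γ.IsFundamentalDomain W' ∧ Γ.HasSupportZero W')
    {k F : Type*} [CommRing k] [Field F] [Algebra k F] [IsAlgClosed F] {x : Γ.Coord → F} {θ : F}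
    (hdet : (Γ.shiftedFloquet W x θ).det = 0)
    (hx : ∀ s, ∃ D : Derivation k F F, ∀ t, D (x t) = if t = s then 1 else 0) :
    ∃ i, (Γ.shiftedFloquet W x θ).adjugate i i = 0 := by
  by_contra! hne
  apply hΓ
  set P := (Γ.shiftedFloquet W x θ).adjugate
  set S := Γ.minorSum W x θ
  choose D hD using hx
  have hvert : ∀ w : W, P w w = AddMonoidAlgebra.single 0 (D (Γ.vertexCoord w) θ) * S := fun w =>
    adjugate_diag_eq hW hdet w (hD _)
  have hrank : ∀ i k l : W, P i l * P k k = P i k * P k l := fun i k l =>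
    Matrix.adjugate_mul_adjugate_of_det_eq_zero hdet (hne k) i l
  have hWne : Nonempty W := by
    by_contra h
    rw [not_nonempty_iff] at h
    rw [Matrix.det_isEmpty] at hdet
    exact one_ne_zero hdet
  have hS : S ≠ 0 := by
    intro h
    obtain ⟨w⟩ := hWne
    exact hne w (by rw [hvert w, h, mul_zero])
  have hc : ∀ w : W, D (Γ.vertexCoord w) θ ≠ 0 := fun w h =>
    hne w (by rw [hvert w, h, AddMonoidAlgebra.single_zero, zero_mul])
  generalize hcdef : (fun w : W => D (Γ.vertexCoord w) θ) = c at *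
  replace hvert : ∀ w : W, P w w = AddMonoidAlgebra.single 0 (c w) * S := fun w => by
    rw [hvert w, ← hcdef]
  replace hc : ∀ w : W, c w ≠ 0 := fun w => by rw [← hcdef]; exact hc w
  have hprod : ∀ u v : W, P v u * P u v = AddMonoidAlgebra.single 0 (c u * c v) * S ^ 2 := by
    intro u v
    rw [← hrank v u v, hvert, hvert, ← add_zero (0 : Fin d → ℤ),
      ← AddMonoidAlgebra.single_mul_single, add_zero]
    ring
  let T : W → W → (Fin d → ℤ) → Prop := fun u v a =>
    ∃ α : F, α ≠ 0 ∧ P v u * AddMonoidAlgebra.single a 1 = AddMonoidAlgebra.single 0 α * S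
  have T_refl : ∀ u, T u u 0 := fun u => ⟨c u, hc u, by
    rw [← AddMonoidAlgebra.one_def, mul_one, hvert]⟩
  have T_symm : ∀ u v a, T u v a → T v u (-a) := by
    rintro u v a ⟨α, hα, h⟩
    refine ⟨c u * c v * α⁻¹, mul_ne_zero (mul_ne_zero (hc u) (hc v)) (inv_ne_zero hα), ?_⟩
    have h1 : (AddMonoidAlgebra.single 0 α : AddMonoidAlgebra F (Fin d → ℤ)) * S ≠ 0 :=
      mul_ne_zero (by simpa using hα) hS
    refine mul_left_cancel₀ h1 ?_
    have h2 : (AddMonoidAlgebra.single 0 (c u * c v) : AddMonoidAlgebra F (Fin d → ℤ)) =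
        AddMonoidAlgebra.single 0 α * AddMonoidAlgebra.single 0 (c u * c v * α⁻¹) := by
      rw [AddMonoidAlgebra.single_mul_single, add_zero]
      congr 1
      field_simp
    have h3 : (AddMonoidAlgebra.single a 1 : AddMonoidAlgebra F (Fin d → ℤ)) *
        AddMonoidAlgebra.single (-a) 1 = 1 := by
      rw [AddMonoidAlgebra.single_mul_single, add_neg_cancel, mul_one, AddMonoidAlgebra.one_def]
    have h4 := hprod u v
    rw [h2] at h4
    rw [← h]
    linear_combination h4 + P v u * P u v * h3 -
      AddMonoidAlgebra.single 0 (c u * c v * α⁻¹) * S * h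
  have T_trans : ∀ u v w a b, T u v a → T v w b → T u w (a + b) := by
    rintro u v w a b ⟨α, hα, h⟩ ⟨β, hβ, h'⟩
    refine ⟨α * β * (c v)⁻¹, mul_ne_zero (mul_ne_zero hα hβ) (inv_ne_zero (hc v)), ?_⟩
    have h1 : (AddMonoidAlgebra.single 0 (c v) : AddMonoidAlgebra F (Fin d → ℤ)) * S ≠ 0 :=
      mul_ne_zero (by simpa using hc v) hS
    refine mul_right_cancel₀ h1 ?_
    have h2 : (AddMonoidAlgebra.single 0 α : AddMonoidAlgebra F (Fin d → ℤ)) *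
        AddMonoidAlgebra.single 0 β =
        AddMonoidAlgebra.single 0 (α * β * (c v)⁻¹) * AddMonoidAlgebra.single 0 (c v) := by
      rw [AddMonoidAlgebra.single_mul_single, AddMonoidAlgebra.single_mul_single]
      congr 1
      have := hc v
      field_simp
    have h3 : (AddMonoidAlgebra.single (a + b) 1 : AddMonoidAlgebra F (Fin d → ℤ)) =
        AddMonoidAlgebra.single a 1 * AddMonoidAlgebra.single b 1 := by
      rw [AddMonoidAlgebra.single_mul_single, mul_one]
    have h4 := hrank w v u
    rw [hvert] at h4
    rw [h3]
    linear_combination AddMonoidAlgebra.single a 1 * AddMonoidAlgebra.single b 1 * h4 +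
      P w v * AddMonoidAlgebra.single b 1 * h + AddMonoidAlgebra.single 0 α * S * h' + S ^ 2 * h2
  have T_unique : ∀ u a, T u u a → a = 0 := by
    rintro u a ⟨α, hα, h⟩
    rw [hvert] at h
    have h1 : (AddMonoidAlgebra.single a (c u) : AddMonoidAlgebra F (Fin d → ℤ)) =
        AddMonoidAlgebra.single 0 α := by
      refine mul_right_cancel₀ hS ?_
      rw [← h, mul_right_comm, AddMonoidAlgebra.single_mul_single, zero_add, mul_one]
    have h2 := congrArg (fun f => AddMonoidAlgebra.coeff f 0) h1
    simp only [AddMonoidAlgebra.coeff_single, Finsupp.single_eq_same] at h2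
    by_contra ha
    rw [Finsupp.single_eq_of_ne (Ne.symm ha)] at h2
    exact hα h2.symm
  have T_edge : ∀ (u v : W) a, Γ.graph.Adj (u : V) (a +ᵥ (v : V)) → T u v a := by
    intro u v a h
    refine exists_eq_single_mul (mul_ne_zero (hc u) (hc v))
      (adjugate_edge_eq hW hdet h (hD _)) ?_
    rw [← hprod u v]
    have h3 : (AddMonoidAlgebra.single a 1 : AddMonoidAlgebra F (Fin d → ℤ)) *
        AddMonoidAlgebra.single (-a) 1 = 1 := by
      rw [AddMonoidAlgebra.single_mul_single, add_neg_cancel, mul_one, AddMonoidAlgebra.one_def]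
    linear_combination P v u * P u v * h3
  -- Every vertex is uniquely `pos x +ᵥ rep x` with `rep x ∈ W`.
  choose pos rep hrep hpos using hW.1
  have hvadd : ∀ (a : Fin d → ℤ) x, rep (a +ᵥ x) = rep x ∧ pos (a +ᵥ x) = a + pos x := by
    intro a x
    refine hW.vadd_inj (hrep _) (hrep _) ?_
    rw [← hpos, add_vadd, ← hpos]
  let r : Setoid V :=
    { r := fun x y => T ⟨rep x, hrep x⟩ ⟨rep y, hrep y⟩ (pos y - pos x)
      iseqv :=
        { refl := fun x => by rw [sub_self]; exact T_refl _
          symm := fun {x y} h => by rw [← neg_sub]; exact T_symm _ _ _ h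
          trans := fun {x y z} h h' => by
            rw [← sub_add_sub_cancel' (pos y) (pos x) (pos z)]
            exact T_trans _ _ _ _ _ h h' } }
  refine hW.exists_hasSupportZero r ?_ ?_ ?_
  · intro a x y h
    change T _ _ _
    simp only [hvadd, add_sub_add_left_eq_sub]
    exact h
  · intro x y h
    refine T_edge _ _ _ ?_
    have h1 : -pos x +ᵥ x = rep x := by
      have := congrArg (-pos x +ᵥ ·) (hpos x)
      simpa only [neg_vadd_vadd] using this
    have h2 : (pos y - pos x) +ᵥ rep y = -pos x +ᵥ y := by
      rw [sub_eq_neg_add, add_vadd, ← hpos]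
    have := Γ.adj_vadd (-pos x) h
    rwa [h1, ← h2] at this
  · intro a x h
    refine T_unique ⟨rep x, hrep x⟩ a ?_
    change T _ _ _ at h
    simpa only [hvadd, add_sub_cancel_right] using h

/-! ### Passage between generic and individual labelings -/

/-- Only the nonvanishing locus of a single nonzero polynomial is needed of the open set. -/
theorem Generic.exists_ne_zero {P : Γ.Labeling → Prop} (h : Generic P) :
    ∃ p : MvPolynomial Γ.Coord ℂ, p ≠ 0 ∧
      ∀ y, MvPolynomial.eval y p ≠ 0 → P (Labeling.ofCoord y) := by
  obtain ⟨O, ⟨Z, hZ⟩, ⟨ℓ, hℓ⟩, hO⟩ := h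
  obtain ⟨y₀, rfl⟩ := ℓ.exists_ofCoord
  have hmem : ∀ y, Labeling.ofCoord y ∈ O ↔ ∃ p ∈ Z,
      MvPolynomial.eval y (MvPolynomial.rename (Sum.elim Γ.vertexCoord Γ.dartCoord) p) ≠ 0 := by
    intro y
    rw [← Set.notMem_compl_iff, hZ]
    simp [Labeling.coord_ofCoord, MvPolynomial.eval_rename]
  obtain ⟨p, hp, hp0⟩ := (hmem y₀).mp hℓ
  refine ⟨_, fun h => hp0 (by rw [h, map_zero]), fun y hy => hO _ ((hmem y).mpr ⟨p, hp, hy⟩)⟩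

open Classical in
theorem det_shiftedFloquet_map {R S : Type*} [CommRing R] [CommRing S] (f : R →+* S)
    (x : Γ.Coord → R) (c : R) :
    AddMonoidAlgebra.mapRingHom (Fin d → ℤ) f (Γ.shiftedFloquet W x c).det =
      (Γ.shiftedFloquet W (f ∘ x) (f c)).det := by
  rw [RingHom.map_det, RingHom.mapMatrix_apply, shiftedFloquet_map]

/-- The evaluation of Laurent polynomials at `z = 1`. -/
theorem exists_augmentation (R G : Type*) [CommRing R] [AddCommMonoid G] :
    ∃ ε : AddMonoidAlgebra R G →+* R, ∀ a r, ε (AddMonoidAlgebra.single a r) = r :=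
  ⟨(AddMonoidAlgebra.lift R R G 1).toRingHom, fun a r => by simp⟩

open Classical in
/-- If `L(z) - c` is singular then `c` is an eigenvalue of the matrix `L(1)`, hence integral over
any ring that contains the labels. -/
theorem isIntegral_of_det_eq_zero {A B : Type*} [CommRing A] [CommRing B] [Algebra A B]
    (x : Γ.Coord → A) (c : B) (h : (Γ.shiftedFloquet W (algebraMap A B ∘ x) c).det = 0) :
    IsIntegral A c := by
  obtain ⟨ε, hε⟩ := exists_augmentation B (Fin d → ℤ)
  obtain ⟨ε', hε'⟩ := exists_augmentation A (Fin d → ℤ)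
  let N : Matrix W W A := (Γ.shiftedFloquet W x 0).map ε'
  refine ⟨N.charpoly, N.charpoly_monic, ?_⟩
  rw [← Polynomial.eval_map, ← Matrix.charpoly_map, Matrix.eval_charpoly]
  have h1 : (Γ.shiftedFloquet W (algebraMap A B ∘ x) c).map ε =
      -(Matrix.scalar W c - N.map (algebraMap A B)) := by
    ext u v
    have hN : algebraMap A B (N u v) = ε (Γ.shiftedFloquet W (algebraMap A B ∘ x) 0 u v) := by
      have hcomm : ∀ f, algebraMap A B (ε' f) =
          ε (AddMonoidAlgebra.mapRingHom (Fin d → ℤ) (algebraMap A B) f) := by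
        intro f
        induction f using AddMonoidAlgebra.induction_linear with
        | zero => simp
        | add f g hf hg => simp only [map_add, hf, hg]
        | single a r => rw [hε', AddMonoidAlgebra.mapRingHom_single, hε]
      have := congrFun (congrFun (Γ.shiftedFloquet_map W (algebraMap A B) x 0) u) v
      rw [map_zero] at this
      rw [← this]
      exact hcomm _
    have hsplit : Γ.shiftedFloquet W (algebraMap A B ∘ x) c u v =
        Γ.shiftedFloquet W (algebraMap A B ∘ x) 0 u v -
          if u = v then AddMonoidAlgebra.single 0 c else 0 := by
      simp only [shiftedFloquet, sub_zero, AddMonoidAlgebra.single_sub]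
      split_ifs
      · abel
      · abel
    simp only [Matrix.map_apply, Matrix.neg_apply, Matrix.sub_apply, Matrix.scalar_apply,
      Matrix.diagonal_apply, hN, hsplit, map_sub]
    split_ifs
    · rw [hε]; ring
    · simp
  have h2 := congrArg ε h
  rw [map_zero, RingHom.map_det, RingHom.mapMatrix_apply, h1, Matrix.det_neg] at h2
  exact (IsUnit.mul_right_eq_zero (isUnit_one.neg.pow _)).mp h2

open Classical in
/-- A constant eigenvalue of the labeling by independent variables that lies in an integral extension
of the polynomial ring can be found in the algebraic closure. -/
theorem exists_eigenvalue_ratFuncClosure {B : Type*} [CommRing B] [IsDomain B]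
    [Algebra (MvPolynomial Γ.Coord ℂ) B]
    (hinj : Function.Injective (algebraMap (MvPolynomial Γ.Coord ℂ) B))
    [Algebra.IsIntegral (MvPolynomial Γ.Coord ℂ) B] {b : B}
    (hdet : (Γ.shiftedFloquet W (algebraMap (MvPolynomial Γ.Coord ℂ) B ∘ MvPolynomial.X) b).det
      = 0) :
    ∃ θ : RatFuncClosure Γ.Coord,
      (Γ.shiftedFloquet W (fun s => algebraMap (MvPolynomial Γ.Coord ℂ) _ (MvPolynomial.X s))
        θ).det = 0 := by
  have : FaithfulSMul (MvPolynomial Γ.Coord ℂ) B :=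
    (faithfulSMul_iff_algebraMap_injective _ _).mpr hinj
  let ψ : B →ₐ[MvPolynomial Γ.Coord ℂ] RatFuncClosure Γ.Coord := IsAlgClosed.lift
  refine ⟨ψ b, ?_⟩
  have h1 := det_shiftedFloquet_map (ψ : B →+* RatFuncClosure Γ.Coord)
    (algebraMap (MvPolynomial Γ.Coord ℂ) B ∘ MvPolynomial.X) b (W := W)
  rw [hdet, map_zero] at h1
  rw [h1]
  congr 2
  ext s
  simp

open Classical in
/-- If the dispersion polynomial of a generic labeling has a linear factor, then so has the
dispersion polynomial of the labeling by independent variables, over an algebraic closure. -/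
theorem exists_generic_eigenvalue
    (hD : Generic fun ℓ : Γ.Labeling => ∃ c : ℂ, HasLinearFactor (ℓ.dispersion W) c) :
    ∃ θ : RatFuncClosure Γ.Coord,
      (Γ.shiftedFloquet W (fun s => algebraMap (MvPolynomial Γ.Coord ℂ) _ (MvPolynomial.X s))
        θ).det = 0 := by
  obtain ⟨p, hp, hpD⟩ := hD.exists_ne_zero
  -- The ideal of the coefficients of `D(z, λ)`, for the labeling by independent variables.
  let Δ := (Γ.shiftedFloquet W (fun s => Polynomial.C (MvPolynomial.X (R := ℂ) s))
    Polynomial.X).det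
  let J : Ideal (Polynomial (MvPolynomial Γ.Coord ℂ)) := Ideal.span (Set.range Δ.coeff)
  let M : Submonoid (Polynomial (MvPolynomial Γ.Coord ℂ)) :=
    (nonZeroDivisors (MvPolynomial Γ.Coord ℂ)).map
      (Polynomial.C : MvPolynomial Γ.Coord ℂ →+* _)
  have hdisj : Disjoint (J : Set (Polynomial (MvPolynomial Γ.Coord ℂ))) M := by
    rw [Set.disjoint_left]
    rintro _ hJ ⟨q, hq, rfl⟩
    have hpq : p * q ≠ 0 := mul_ne_zero hp (nonZeroDivisors.ne_zero hq)
    obtain ⟨y, hy⟩ : ∃ y, MvPolynomial.eval y (p * q) ≠ 0 := by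
      by_contra! h
      exact hpq (MvPolynomial.funext fun y => by rw [h, map_zero])
    rw [map_mul] at hy
    obtain ⟨c, hc⟩ := hpD y (left_ne_zero_of_mul hy)
    rw [hasLinearFactor_dispersion_ofCoord] at hc
    let φ : Polynomial (MvPolynomial Γ.Coord ℂ) →+* ℂ :=
      Polynomial.eval₂RingHom (MvPolynomial.eval y) c
    have hJφ : J ≤ RingHom.ker φ := by
      refine Ideal.span_le.mpr ?_
      rintro _ ⟨a, rfl⟩
      have h1 := det_shiftedFloquet_map (Γ := Γ) (W := W) φ
        (fun s => Polynomial.C (MvPolynomial.X (R := ℂ) s)) Polynomial.X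
      have h2 : φ ∘ (fun s => Polynomial.C (MvPolynomial.X (R := ℂ) s)) = y := by
        ext s
        simp [φ]
      have h3 : φ Polynomial.X = c := by simp [φ]
      rw [h2, h3, hc] at h1
      have h4 := congrArg (fun f => AddMonoidAlgebra.coeff f a) h1
      simpa using h4
    have := hJφ hJ
    rw [RingHom.mem_ker] at this
    refine right_ne_zero_of_mul hy ?_
    simpa [φ] using this
  obtain ⟨Q, hQ, hJQ, hQM⟩ := J.exists_le_prime_disjoint M hdisj
  let π : Polynomial (MvPolynomial Γ.Coord ℂ) →+* Polynomial (MvPolynomial Γ.Coord ℂ) ⧸ Q :=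
    Ideal.Quotient.mk Q
  have hinj : Function.Injective
      (algebraMap (MvPolynomial Γ.Coord ℂ) (Polynomial (MvPolynomial Γ.Coord ℂ) ⧸ Q)) := by
    rw [injective_iff_map_eq_zero]
    intro q hq
    by_contra hq0
    exact Set.disjoint_left.mp hQM (Ideal.Quotient.eq_zero_iff_mem.mp hq)
      ⟨q, mem_nonZeroDivisors_of_ne_zero hq0, rfl⟩
  have hdet : (Γ.shiftedFloquet W (algebraMap (MvPolynomial Γ.Coord ℂ)
      (Polynomial (MvPolynomial Γ.Coord ℂ) ⧸ Q) ∘ MvPolynomial.X) (π Polynomial.X)).det = 0 := by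
    have h1 := det_shiftedFloquet_map (Γ := Γ) (W := W)
        (S := Polynomial (MvPolynomial Γ.Coord ℂ) ⧸ Q) π
        (fun s => Polynomial.C (MvPolynomial.X (R := ℂ) s)) Polynomial.X
    refine Eq.trans h1.symm ?_
    ext a
    rw [AddMonoidAlgebra.coeff_mapRingHom]
    exact Ideal.Quotient.eq_zero_iff_mem.mpr (hJQ (Ideal.subset_span ⟨a, rfl⟩))
  have hint := isIntegral_of_det_eq_zero _ _ hdet
  have : Algebra.IsIntegral (MvPolynomial Γ.Coord ℂ)
      (Polynomial (MvPolynomial Γ.Coord ℂ) ⧸ Q) := by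
    refine ⟨fun b => ?_⟩
    obtain ⟨f, rfl⟩ := Ideal.Quotient.mk_surjective b
    have : Ideal.Quotient.mk Q f = Polynomial.aeval (π Polynomial.X) f := by
      have h : Ideal.Quotient.mkₐ (MvPolynomial Γ.Coord ℂ) Q =
          Polynomial.aeval (π Polynomial.X) := by
        ext
        simp [π]
      exact congrArg (fun g => g f) h
    rw [this]
    exact IsIntegral.of_mem_of_fg _ hint.fg_adjoin_singleton _
      (Polynomial.aeval_mem_adjoin_singleton _ _)
  exact exists_eigenvalue_ratFuncClosure hinj hdet

open Classical in
/-- Linear factors over the algebraic closure specialize to linear factors for every labeling. -/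
theorem exists_specialization {θ : RatFuncClosure Γ.Coord}
    (hdet : (Γ.shiftedFloquet W (fun s => algebraMap (MvPolynomial Γ.Coord ℂ) _
      (MvPolynomial.X s)) θ).det = 0) {i : W}
    (hi : (Γ.shiftedFloquet W (fun s => algebraMap (MvPolynomial Γ.Coord ℂ) _
      (MvPolynomial.X s)) θ).adjugate i i = 0) (y : Γ.Coord → ℂ) :
    ∃ c : ℂ, (Γ.shiftedFloquet W y c).adjugate i i = 0 ∧ (Γ.shiftedFloquet W y c).det = 0 := by
  set B := integralClosure (MvPolynomial Γ.Coord ℂ) (RatFuncClosure Γ.Coord)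
  let θ' : B := ⟨θ, isIntegral_of_det_eq_zero MvPolynomial.X θ hdet⟩
  let x : Γ.Coord → B := fun s => algebraMap (MvPolynomial Γ.Coord ℂ) B (MvPolynomial.X s)
  have hinj : Function.Injective (AddMonoidAlgebra.mapRingHom (Fin d → ℤ)
      (algebraMap B (RatFuncClosure Γ.Coord))) := by
    intro f g h
    ext a
    have := congrArg (fun f => AddMonoidAlgebra.coeff f a) h
    simp only [AddMonoidAlgebra.coeff_mapRingHom] at this
    exact this
  have hmap : (Γ.shiftedFloquet W x θ').map
      (AddMonoidAlgebra.mapRingHom (Fin d → ℤ) (algebraMap B (RatFuncClosure Γ.Coord))) =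
      Γ.shiftedFloquet W (fun s => algebraMap (MvPolynomial Γ.Coord ℂ) _
        (MvPolynomial.X s)) θ := shiftedFloquet_map _ _ _ _ _
  obtain ⟨Φ, hΦ⟩ := MvPolynomial.exists_eval_extension (B := B)
    (fun a b h => RatFuncClosure.algebraMap_injective _ (congrArg Subtype.val h)) y
  have hmap' : (Γ.shiftedFloquet W x θ').map (AddMonoidAlgebra.mapRingHom (Fin d → ℤ) Φ) =
      Γ.shiftedFloquet W y (Φ θ') := by
    rw [shiftedFloquet_map]
    congr 1
    ext s
    exact (hΦ _).trans (MvPolynomial.eval_X _)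
  refine ⟨Φ θ', ?_, ?_⟩
  · rw [← hmap', ← RingHom.mapMatrix_apply, ← RingHom.map_adjugate, RingHom.mapMatrix_apply,
      Matrix.map_apply]
    rw [← hmap, ← RingHom.mapMatrix_apply, ← RingHom.map_adjugate, RingHom.mapMatrix_apply,
      Matrix.map_apply, ← map_zero (AddMonoidAlgebra.mapRingHom (Fin d → ℤ)
        (algebraMap B (RatFuncClosure Γ.Coord)))] at hi
    rw [hinj hi, map_zero]
  · rw [← hmap', ← RingHom.mapMatrix_apply, ← RingHom.map_det]
    rw [← hmap, ← RingHom.mapMatrix_apply, ← RingHom.map_det,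
      ← map_zero (AddMonoidAlgebra.mapRingHom (Fin d → ℤ)
        (algebraMap B (RatFuncClosure Γ.Coord)))] at hdet
    rw [hinj hdet, map_zero]

end PeriodicGraph

theorem mainTheorem3 {d : ℕ} {V : Type*} [AddAction (Fin d → ℤ) V] [DecidableEq V]
    (Γ : PeriodicGraph d V) (W : Finset V) (hW : Γ.IsFundamentalDomain W)
    (hΓ : ¬ ∃ W' : Finset V, Γ.IsFundamentalDomain W' ∧ Γ.HasSupportZero W')
    (hD : PeriodicGraph.Generic fun ℓ : Γ.Labeling =>
      ∃ c : ℂ, PeriodicGraph.HasLinearFactor (ℓ.dispersion W) c) :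
    PeriodicGraph.Generic fun ℓ : Γ.Labeling =>
      ∃ i ∈ W, ∃ c : ℂ, PeriodicGraph.HasLinearFactor (ℓ.inducedDispersion (W.erase i)) c ∧
        PeriodicGraph.HasLinearFactor (ℓ.dispersion W) c := by
  classical
  obtain ⟨θ, hθ⟩ := PeriodicGraph.exists_generic_eigenvalue hD
  obtain ⟨i, hi⟩ := PeriodicGraph.exists_adjugate_eq_zero hW hΓ hθ fun s => by
    obtain ⟨D, hD⟩ := RatFuncClosure.exists_derivation s
    exact ⟨D, fun t => by rw [hD]⟩
  -- The conclusion holds for every labeling, not only for a generic one.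
  refine ⟨Set.univ, ⟨{1}, by simp⟩, ⟨PeriodicGraph.Labeling.ofCoord 0, trivial⟩, fun ℓ _ => ?_⟩
  obtain ⟨y, rfl⟩ := ℓ.exists_ofCoord
  obtain ⟨c, hci, hc⟩ := PeriodicGraph.exists_specialization hθ hi y
  refine ⟨i, i.2, c, ?_, (PeriodicGraph.hasLinearFactor_dispersion_ofCoord y W c).mpr hc⟩
  convert (PeriodicGraph.hasLinearFactor_inducedDispersion_ofCoord y W i c).mpr hci
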